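/- Let $d\ge 1$ and $\varepsilon\in(0,1/(2d)]$ be fixed. On a probability space $(\Omega,\mathcal F,P)$ let $\eta(x)$, $x\in\mathbb Z^d$, be $\mathbb N_0$-valued random variables ($\eta(x)$ is the number of frogs initially sleeping at $x$) and let $(S_j(x,i))_{j\ge 0}$, $x\in\mathbb Z^d$, $i\ge 1$, be $\mathbb Z^d$-valued processes with $S_0(x,i)=x$ ($S_j(x,i)$ is the position of the $i$-th frog of $x$, $j$ steps after it is woken up). Recurrence is defined realization by realization. For $v\in\mathbb Z^d$ let $W^v_0=\{v\}$ and, for $j\ge 1$, let $W^v_j$ be the set of all $x\notin\bigcup_{k<j}W^v_k$ such that $S_{j-k}(y,i)=x$ for some $k<j$, $y\in W^v_k$ and $1\le i\le\eta(y)$; let $W^v=\bigcup_{j\ge 0}W^v_j$. The site $v$ is called recurrent if there are infinitely many distinct $x\in W^v$ for which there are $1\le i\le\eta(x)$ and $j\ge 0$ with $S_j(x,i)=v$. Suppose that for all $x\in\mathbb Z^d$, $i\ge1$, $j\ge 0$ and all unit vectors $e\in\mathbb Z^d$, $P$-a.s. $$P\left[S_{j+1}(x,i)=S_j(x,i)+e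 \mid (S_k(x,i))_{0\le k\le j}\right]\ge\varepsilon ,$$ that the $\eta(x)$, $x\in\mathbb Z^d$, are identically distributed, and that the quantities $\eta(x)$, $(S_j(x,i))_{j\ge0}$, $x\in\mathbb Z^d$, $i\ge 1$, are independent. Then there is a constant $c>0$ which depends only on $d$ and $\varepsilon$ such that, if $$P[\eta(0)\ge t]\ge \frac{c}{(\log t)^d}\qquad\text{for all large } t,$$ then with probability $1$ every $x\in\mathbb Z^d$ with $\eta(x)\ge 1$ is recurrent. If $d=1$ and, in addition, the frogs make no long jumps, i.e. $|S_{j+1}(x,i)-S_j(x,i)|\le 1$ a.s. for all $x,i,j$, then the tail condition can be replaced by the weaker moment assumption $E[\log_+\eta(0)]=\infty$. -/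

import Mathlib

open MeasureTheory ProbabilityTheory Filter

namespace FrogModel

/-- For a frog configuration (`n x` frogs sleeping at `x`, labelled by `i < n x`; the `i`-th frog of
`x`, once woken, is at `s j x i` after `j` steps), `firstVisited n s v j` is the set of sites which,
if the frogs at `v` are woken at time `0`, are visited at time `j` for the first time by an active
frog (with the convention that `v` itself is visited at time `0`). -/
def firstVisited {V : Type*} (n : V → ℕ) (s : ℕ → V → ℕ → V) (v : V) : ℕ → Set V
  | 0 => {v}
  | j + 1 => {x | (∀ k : Fin (j + 1), x ∉ firstVisited n s v k) ∧
      ∃ k : Fin (j + 1), ∃ y ∈ firstVisited n s v k, ∃ i < n y, s (j + 1 - k) y i = x}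

/-- The set of all sites visited by active frogs after waking the frogs at `v`. -/
def visited {V : Type*} (n : V → ℕ) (s : ℕ → V → ℕ → V) (v : V) : Set V :=
  ⋃ j, firstVisited n s v j

/-- The site `v` is recurrent: there are infinitely many distinct visited sites `x` at least one of
whose (finitely many) frogs ever visits `v`. -/
def IsRecurrent {V : Type*} (n : V → ℕ) (s : ℕ → V → ℕ → V) (v : V) : Prop :=
  {x | x ∈ visited n s v ∧ ∃ i < n x, ∃ j, s j x i = v}.Infinite

/-- A random frog configuration on `ℤ^d` with frog numbers `η x` and trajectories
`j ↦ S j x i` (`i`-th frog of `x`, labels starting from `0`) such that the trajectories are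
`ε`-uniformly elliptic, the frog numbers are identically distributed, and all the frog numbers and
all the trajectories are jointly independent. -/
structure IsEllipticFrogProcess {d : ℕ} (ε : ℝ) {Ω : Type*} [MeasurableSpace Ω] (P : Measure Ω)
    (η : (Fin d → ℤ) → Ω → ℕ) (S : ℕ → (Fin d → ℤ) → ℕ → Ω → (Fin d → ℤ)) : Prop where
  measurable_number : ∀ x, Measurable (η x)
  measurable_position : ∀ j x i, Measurable (S j x i)
  start : ∀ x i ω, S 0 x i ω = x
  elliptic : ∀ (x : Fin d → ℤ) (i j : ℕ) (e : Fin d → ℤ), ∑ k, |e k| = 1 →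
    ∀ᵐ ω ∂P, ε ≤ (P⟦{ω' | S (j + 1) x i ω' = S j x i ω' + e} |
      ⨆ k ∈ Set.Iic j, MeasurableSpace.comap (S k x i) inferInstance⟧) ω
  identDistrib : ∀ x y, IdentDistrib (η x) (η y) P P
  indep : iIndep (Sum.elim
    (fun x : Fin d → ℤ => MeasurableSpace.comap (η x) inferInstance)
    (fun p : (Fin d → ℤ) × ℕ =>
      MeasurableSpace.comap (fun ω (j : ℕ) => S j p.1 p.2 ω) inferInstance)) P

end FrogModel

/-! By ellipticity a frog travels a given displacement of `ℓ¹`-length `n` with probability at least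
`ε ^ n`, so a site with at least `ε⁻¹ ^ n` frogs hits a target within distance `n` with probability
at least 1/2. Hit probabilities are thus at least half of `P[η(0) ≥ ε⁻¹ ^ n]`, hence at least a
constant times `n ^ (-d)`, with the constant as large as `c` demands. A dyadic cube of `2 ^ (j d)`
sites at distance of order `2 ^ j` then misses its corner with probability at most `2 ^ (-(d + 1))`,
whatever `j`. A union bound over annuli, in which `2 ^ (d r)` is lost to counting and `2 ^ (-r)`
survives, shows that an orthant is entirely visited from its corner with probability bounded below
(`exists_le_fill_inter_grow_prob`).

A frog of `v` almost surely visits infinitely many sites `y`. The orthant at `y` that points away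
from `v` uses only sites at least as far out as `y`, so Kolmogorov's zero-one law makes the frog
meet a successful corner (`ae_exists_path_mem`). The resulting orthant contains all far points of an
orthant at `v`, infinitely many of which send a frog to `v` (`ae_hits_from_orthant`).

In dimension one without long jumps, a single frog of `v` sweeps a whole half-line. Infinitely many
returns from there follow from the second Borel–Cantelli lemma, and this needs only the logarithmic
moment condition. -/

namespace FrogModel

/-! ### Deterministic spread of the visited set. -/

section Deterministic

variable {V : Type*} {n : V → ℕ} {s : ℕ → V → ℕ → V} {v : V}

theorem self_mem_visited : v ∈ visited n s v :=
  Set.mem_iUnion.2 ⟨0, by rw [firstVisited]; rfl⟩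

/-- A site reached at a given time was either discovered earlier or is discovered right then. This
closure property is all that the probabilistic part uses about the recursion. -/
theorem mem_visited_of_step (hs : ∀ y i, s 0 y i = y) {y : V} (hy : y ∈ visited n s v) {i : ℕ}
    (hi : i < n y) (j : ℕ) : s j y i ∈ visited n s v := by
  obtain ⟨k, hk⟩ := Set.mem_iUnion.1 hy
  rcases j with _ | j
  · rwa [hs]
  by_cases hx : ∃ k' : Fin (k + j + 1), s (j + 1) y i ∈ firstVisited n s v k'
  · obtain ⟨k', hk'⟩ := hx
    exact Set.mem_iUnion.2 ⟨k', hk'⟩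
  · push Not at hx
    refine Set.mem_iUnion.2 ⟨k + j + 1, ?_⟩
    rw [firstVisited]
    refine ⟨hx, ⟨k, by omega⟩, y, hk, i, hi, ?_⟩
    congr 1
    simp only
    omega

end Deterministic

/-- The `ℓ¹`-length of an integer vector. -/
def length {d : ℕ} (w : Fin d → ℤ) : ℕ := ∑ k, (w k).natAbs

theorem exists_unit_of_length_eq_succ {d n : ℕ} {w : Fin d → ℤ} (hw : length w = n + 1) :
    ∃ w' e : Fin d → ℤ, w = w' + e ∧ length w' = n ∧ ∑ k, |e k| = 1 := by
  obtain ⟨l, hl⟩ : ∃ l, w l ≠ 0 := by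
    by_contra! h
    simp [length, h] at hw
  refine ⟨w - Pi.single l (w l).sign, Pi.single l (w l).sign, by simp, ?_, ?_⟩
  · have h1 : ∀ u : Fin d → ℤ, length u = (u l).natAbs + ∑ k ∈ Finset.univ.erase l, (u k).natAbs :=
      fun u => (Finset.add_sum_erase _ _ (Finset.mem_univ l)).symm
    have h2 : ∑ k ∈ Finset.univ.erase l, ((w - Pi.single l (w l).sign : Fin d → ℤ) k).natAbs
        = ∑ k ∈ Finset.univ.erase l, (w k).natAbs := by
      refine Finset.sum_congr rfl fun k hk => ?_
      simp [Finset.ne_of_mem_erase hk]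
    rw [h1] at hw ⊢
    rw [h2]
    have h3 : ((w - Pi.single l (w l).sign : Fin d → ℤ) l).natAbs + 1 = (w l).natAbs := by
      simp only [Pi.sub_apply, Pi.single_eq_same]
      rcases lt_or_gt_of_ne hl with h | h
      · rw [Int.sign_eq_neg_one_of_neg h]; omega
      · rw [Int.sign_eq_one_of_pos h]; omega
    omega
  · rw [Finset.sum_eq_single l]
    · simp only [Pi.single_eq_same]
      rcases lt_or_gt_of_ne hl with h | h
      · rw [Int.sign_eq_neg_one_of_neg h]; rfl
      · rw [Int.sign_eq_one_of_pos h]; rfl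
    · intro k _ hk
      simp [hk]
    · simp

/-! ### Consequences of ellipticity for one trajectory. -/

section SingleFrog

variable {d : ℕ} {Ω : Type*} {S : ℕ → (Fin d → ℤ) → ℕ → Ω → (Fin d → ℤ)}

/-- The information contained in the first `j` steps of a frog. -/
abbrev history (S : ℕ → (Fin d → ℤ) → ℕ → Ω → (Fin d → ℤ)) (x : Fin d → ℤ) (i j : ℕ) :
    MeasurableSpace Ω :=
  ⨆ k ∈ Set.Iic j, MeasurableSpace.comap (S k x i) inferInstance

theorem measurable_history (x : Fin d → ℤ) (i : ℕ) {j k : ℕ} (hk : k ≤ j) :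
    Measurable[history S x i j] (S k x i) :=
  Measurable.mono (comap_measurable _)
    (le_iSup₂_of_le (f := fun k (_ : k ∈ Set.Iic j) => MeasurableSpace.comap (S k x i) inferInstance)
      k hk le_rfl) le_rfl

theorem history_mono (x : Fin d → ℤ) (i : ℕ) {j k : ℕ} (hk : k ≤ j) :
    history S x i k ≤ history S x i j :=
  iSup₂_le fun r hr => le_iSup₂_of_le
    (f := fun k (_ : k ∈ Set.Iic j) => MeasurableSpace.comap (S k x i) inferInstance)
    r (le_trans hr hk) le_rfl

variable {ε : ℝ} [MeasurableSpace Ω] {P : Measure Ω} {η : (Fin d → ℤ) → Ω → ℕ}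

theorem IsEllipticFrogProcess.history_le (h : IsEllipticFrogProcess ε P η S) (x : Fin d → ℤ)
    (i j : ℕ) : history S x i j ≤ ‹MeasurableSpace Ω› :=
  iSup₂_le fun k _ => (h.measurable_position k x i).comap_le

variable [IsProbabilityMeasure P]

theorem IsEllipticFrogProcess.step_prob (h : IsEllipticFrogProcess ε P η S) (x : Fin d → ℤ)
    (i j : ℕ) {e : Fin d → ℤ} (he : ∑ k, |e k| = 1) {D : Set Ω}
    (hD : MeasurableSet[history S x i j] D) :
    ε * P.real D ≤ P.real (D ∩ {ω | S (j + 1) x i ω = S j x i ω + e}) := by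
  set E : Set Ω := {ω | S (j + 1) x i ω = S j x i ω + e} with hE
  have hEm : MeasurableSet E :=
    measurableSet_eq_fun (h.measurable_position _ _ _)
      ((h.measurable_position _ _ _).add_const e)
  have hm := h.history_le x i j
  have hDm := hm _ hD
  have h1 : ∫ ω in D, (P⟦E | history S x i j⟧) ω ∂P = P.real (D ∩ E) := by
    rw [setIntegral_condExp hm ((integrable_const (1 : ℝ)).indicator hEm) hD,
      setIntegral_indicator hEm]
    simp
  have h2 : ∫ _ in D, ε ∂P ≤ ∫ ω in D, (P⟦E | history S x i j⟧) ω ∂P := by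
    refine integral_mono_ae (integrable_const _) integrable_condExp.integrableOn ?_
    exact ae_restrict_of_ae (h.elliptic x i j e he)
  rw [h1] at h2
  simpa [mul_comm] using h2

/-- Follow a shortest lattice path and pay `ε` per step. The arbitrary past event `D` allows the
bound to be iterated over successive time windows. -/
theorem IsEllipticFrogProcess.reach_prob (h : IsEllipticFrogProcess ε P η S) (hε : 0 < ε)
    (x : Fin d → ℤ)
    (i j n : ℕ) (w : Fin d → ℤ) (hw : length w = n) {D : Set Ω}
    (hD : MeasurableSet[history S x i j] D) :
    ε ^ n * P.real D ≤ P.real (D ∩ {ω | S (j + n) x i ω = S j x i ω + w}) := by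
  induction n generalizing w with
  | zero =>
    have : w = 0 := by
      funext k
      simpa using (Finset.sum_eq_zero_iff.1 hw) k (Finset.mem_univ k)
    simp [this]
  | succ n ih =>
    obtain ⟨w', e, rfl, hw', he⟩ := exists_unit_of_length_eq_succ hw
    have hm : MeasurableSet[history S x i (j + n)]
        (D ∩ {ω | S (j + n) x i ω = S j x i ω + w'}) := by
      refine MeasurableSet.inter (history_mono x i (Nat.le_add_right j n) _ hD) ?_
      exact measurableSet_eq_fun (measurable_history x i le_rfl)
        ((measurable_history x i (Nat.le_add_right j n)).add_const w')
    calc ε ^ (n + 1) * P.real D = ε * (ε ^ n * P.real D) := by ring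
      _ ≤ ε * P.real (D ∩ {ω | S (j + n) x i ω = S j x i ω + w'}) := by
          gcongr
          exact ih w' hw'
      _ ≤ _ := h.step_prob x i (j + n) he hm
      _ ≤ _ := by
          refine measureReal_mono ?_
          rintro ω ⟨⟨h1, h2⟩, h3⟩
          refine ⟨h1, ?_⟩
          simp only [Set.mem_ofPred_eq] at h2 h3 ⊢
          rw [← add_assoc, h3, h2, add_assoc]

theorem IsEllipticFrogProcess.path_hit_prob (h : IsEllipticFrogProcess ε P η S) (hε : 0 < ε)
    (x z : Fin d → ℤ) (i : ℕ) :
    ε ^ length (z - x) ≤ P.real {ω | ∃ j, S j x i ω = z} := by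
  have := h.reach_prob hε x i 0 _ (z - x) rfl (D := Set.univ) MeasurableSet.univ
  simp only [probReal_univ, mul_one, Set.univ_inter] at this
  refine this.trans (measureReal_mono ?_)
  intro ω hω
  simp only [Set.mem_ofPred_eq, h.start] at hω
  exact ⟨_, by rw [hω]; simp⟩

theorem length_single {d : ℕ} (l : Fin d) (m : ℕ) : length (Pi.single l (m : ℤ)) = m := by
  rw [length, Finset.sum_eq_single l]
  · simp
  · intro k _ hk
    simp [hk]
  · simp

theorem IsEllipticFrogProcess.ae_unbounded (h : IsEllipticFrogProcess ε P η S) (hε : 0 < ε)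
    (hε1 : ε ≤ 1) (x : Fin d → ℤ) (i : ℕ) (l : Fin d) :
    ∀ᵐ ω ∂P, ∀ N : ℕ, ∃ j, (N : ℤ) < |S j x i ω l| := by
  rw [ae_all_iff]
  intro N
  -- A displacement of `2N + 1` leads from anywhere in `[-N, N]` out of it, so each window of `M`
  -- steps offers an escape of conditional probability at least `ε ^ M`.
  set M := 2 * N + 1 with hM
  set D : ℕ → Set Ω := fun k => {ω | ∀ r ≤ k, |S (r * M) x i ω l| ≤ (N : ℤ)} with hDdef
  have hD : ∀ k, MeasurableSet[history S x i (k * M)] (D k) := by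
    intro k
    have : D k = ⋂ r, ⋂ (_ : r ≤ k), S (r * M) x i ⁻¹' {y | |y l| ≤ (N : ℤ)} := by
      ext ω; simp [hDdef]
    rw [this]
    refine MeasurableSet.iInter fun r => MeasurableSet.iInter fun hr => ?_
    exact measurable_history x i (Nat.mul_le_mul_right M hr) (MeasurableSet.of_discrete)
  have hstep : ∀ k, P.real (D (k + 1)) ≤ (1 - ε ^ M) * P.real (D k) := by
    intro k
    have h1 := h.reach_prob hε x i (k * M) M (Pi.single l (M : ℤ)) (length_single l M) (hD k)
    have hsub : D (k + 1) ⊆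
        D k \ (D k ∩ {ω | S (k * M + M) x i ω = S (k * M) x i ω + Pi.single l (M : ℤ)}) := by
      intro ω hω
      refine ⟨fun r hr => hω r (by omega), ?_⟩
      rintro ⟨-, h2⟩
      have h3 := hω (k + 1) le_rfl
      have h4 := hω k (by omega)
      have h5 := congrFun h2 l
      simp only [Pi.add_apply, Pi.single_eq_same] at h5
      rw [Nat.succ_mul, h5] at h3
      rw [abs_le] at h3 h4
      have hM' : (M : ℤ) = 2 * N + 1 := by simp [hM]
      omega
    have hm2 : MeasurableSet
        (D k ∩ {ω | S (k * M + M) x i ω = S (k * M) x i ω + Pi.single l (M : ℤ)}) :=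
      (h.history_le _ _ _ _ (hD k)).inter (measurableSet_eq_fun (h.measurable_position _ _ _)
      ((h.measurable_position _ _ _).add_const _))
    have h2 := measureReal_mono (μ := P) hsub
    rw [measureReal_sdiff Set.inter_subset_left hm2] at h2
    linarith
  have hε0 : 0 ≤ 1 - ε ^ M := by
    have := pow_le_one₀ (n := M) hε.le hε1
    linarith
  have hpow : ∀ k, P.real (D k) ≤ (1 - ε ^ M) ^ k := by
    intro k
    induction k with
    | zero => simp
    | succ k ih =>
      calc _ ≤ _ := hstep k
        _ ≤ (1 - ε ^ M) * (1 - ε ^ M) ^ k := by gcongr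
        _ = _ := by ring
  have hzero : P.real {ω | ¬ ∃ j, (N : ℤ) < |S j x i ω l|} = 0 := by
    refine le_antisymm ?_ measureReal_nonneg
    refine ge_of_tendsto' (tendsto_pow_atTop_nhds_zero_of_lt_one hε0 ?_) fun k =>
      le_trans (measureReal_mono ?_) (hpow k)
    · have := pow_pos hε M
      linarith
    · intro ω hω r _
      simp only [Set.mem_ofPred_eq, not_exists, not_lt] at hω
      exact hω _
  rw [ae_iff]
  exact (measureReal_eq_zero_iff).1 hzero

theorem IsEllipticFrogProcess.ae_infinite_range (h : IsEllipticFrogProcess ε P η S) (hε : 0 < ε)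
    (hε1 : ε ≤ 1) (hd : 1 ≤ d) (x : Fin d → ℤ) (i : ℕ) :
    ∀ᵐ ω ∂P, (Set.range fun j => S j x i ω).Infinite := by
  filter_upwards [h.ae_unbounded hε hε1 x i ⟨0, hd⟩] with ω hω hfin
  obtain ⟨N, hN⟩ := (hfin.image fun y => |y ⟨0, hd⟩|).bddAbove
  obtain ⟨j, hj⟩ := hω N.toNat
  have := hN ⟨_, ⟨j, rfl⟩, rfl⟩
  simp only at this
  omega

end SingleFrog

/-- Independence survives grouping along a partition. Here it turns independent frog numbers and
trajectories into independent sites. -/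
theorem iIndep_iSup_fiber {ι κ Ω : Type*} {m0 : MeasurableSpace Ω} {P : Measure Ω}
    [IsProbabilityMeasure P] {m : ι → MeasurableSpace Ω} (hle : ∀ i, m i ≤ m0) (hm : iIndep m P)
    (g : ι → κ) : iIndep (fun k => ⨆ i ∈ g ⁻¹' {k}, m i) P := by
  classical
  rw [iIndep_iff]
  intro s f hf
  induction s using Finset.induction_on with
  | empty => simp
  | insert k s hk ih =>
    have hdis : Disjoint (g ⁻¹' {k}) (g ⁻¹' (s : Set κ)) := by
      refine Disjoint.preimage g ?_
      simpa using hk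
    have hind := indep_iSup_of_disjoint hle hm hdis
    rw [Finset.set_biInter_insert, Finset.prod_insert hk,
      ← ih fun i hi => hf i (Finset.mem_insert_of_mem hi)]
    refine (Indep_iff _ _ P).1 hind _ _ (hf k (Finset.mem_insert_self k s)) ?_
    refine MeasurableSet.biInter s.countable_toSet fun i hi => ?_
    refine (iSup₂_le fun r hr => ?_ :
      (⨆ r ∈ g ⁻¹' {i}, m r) ≤ ⨆ r ∈ g ⁻¹' (s : Set κ), m r) _ (hf i (Finset.mem_insert_of_mem hi))
    have hr' : r ∈ g ⁻¹' (s : Set κ) := by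
      have : g r = i := hr
      simpa [this] using hi
    exact le_iSup₂_of_le (f := fun r (_ : r ∈ g ⁻¹' (s : Set κ)) => m r) r hr' le_rfl

/-! ### Hitting probabilities from one site. -/

section Sites

variable {d : ℕ} {Ω : Type*}

/-- The σ-algebras of the frog numbers and of the trajectories. -/
abbrev atomSigma (η : (Fin d → ℤ) → Ω → ℕ) (S : ℕ → (Fin d → ℤ) → ℕ → Ω → (Fin d → ℤ)) :
    (Fin d → ℤ) ⊕ ((Fin d → ℤ) × ℕ) → MeasurableSpace Ω :=
  Sum.elim
    (fun x : Fin d → ℤ => MeasurableSpace.comap (η x) inferInstance)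
    (fun p : (Fin d → ℤ) × ℕ =>
      MeasurableSpace.comap (fun ω (j : ℕ) => S j p.1 p.2 ω) inferInstance)

/-- The σ-algebra generated by the frogs of one site. -/
abbrev siteSigma (η : (Fin d → ℤ) → Ω → ℕ) (S : ℕ → (Fin d → ℤ) → ℕ → Ω → (Fin d → ℤ))
    (x : Fin d → ℤ) : MeasurableSpace Ω :=
  ⨆ p ∈ Sum.elim id Prod.fst ⁻¹' {x}, atomSigma η S p

/-- Some frog of `x` ever visits `z`. -/
def hitEvent (η : (Fin d → ℤ) → Ω → ℕ) (S : ℕ → (Fin d → ℤ) → ℕ → Ω → (Fin d → ℤ))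
    (x z : Fin d → ℤ) : Set Ω :=
  {ω | ∃ i < η x ω, ∃ j, S j x i ω = z}

variable {η : (Fin d → ℤ) → Ω → ℕ} {S : ℕ → (Fin d → ℤ) → ℕ → Ω → (Fin d → ℤ)}

theorem measurable_number_siteSigma (x : Fin d → ℤ) : Measurable[siteSigma η S x] (η x) :=
  Measurable.mono (comap_measurable _)
    (le_iSup₂_of_le (f := fun p (_ : p ∈ Sum.elim id Prod.fst ⁻¹' {x}) => atomSigma η S p)
      (Sum.inl x) rfl le_rfl) le_rfl

theorem measurable_path_siteSigma (x : Fin d → ℤ) (i : ℕ) :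
    Measurable[siteSigma η S x] (fun ω (j : ℕ) => S j x i ω) :=
  Measurable.mono (comap_measurable _)
    (le_iSup₂_of_le (f := fun p (_ : p ∈ Sum.elim id Prod.fst ⁻¹' {x}) => atomSigma η S p)
      (Sum.inr (x, i)) rfl le_rfl) le_rfl

theorem measurableSet_path_hit_comap (x z : Fin d → ℤ) (i : ℕ) :
    MeasurableSet[MeasurableSpace.comap (fun ω (j : ℕ) => S j x i ω) inferInstance]
      {ω | ∃ j, S j x i ω = z} := by
  refine ⟨{p | ∃ j, p j = z}, ?_, rfl⟩
  have : {p : ℕ → Fin d → ℤ | ∃ j, p j = z} = ⋃ j, {p | p j = z} := by ext; simp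
  rw [this]
  exact MeasurableSet.iUnion fun j => measurableSet_eq_fun (measurable_pi_apply j) measurable_const

theorem measurableSet_hitEvent_siteSigma (x z : Fin d → ℤ) :
    MeasurableSet[siteSigma η S x] (hitEvent η S x z) := by
  have : hitEvent η S x z = ⋃ i, (η x ⁻¹' {k | i < k} ∩ {ω | ∃ j, S j x i ω = z}) := by
    ext; simp [hitEvent]
  rw [this]
  refine MeasurableSet.iUnion fun i => MeasurableSet.inter ?_ ?_
  · exact measurable_number_siteSigma x MeasurableSet.of_discrete
  · exact (measurable_path_siteSigma x i).comap_le _ (measurableSet_path_hit_comap x z i)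

variable {ε : ℝ} [MeasurableSpace Ω] {P : Measure Ω}

theorem IsEllipticFrogProcess.atomSigma_le (h : IsEllipticFrogProcess ε P η S) (p) :
    atomSigma η S p ≤ ‹MeasurableSpace Ω› := by
  rcases p with x | ⟨x, i⟩
  · exact (h.measurable_number x).comap_le
  · exact (measurable_pi_lambda _ fun j => h.measurable_position j x i).comap_le

theorem IsEllipticFrogProcess.siteSigma_le (h : IsEllipticFrogProcess ε P η S)
    (x : Fin d → ℤ) : siteSigma η S x ≤ ‹MeasurableSpace Ω› :=
  iSup₂_le fun p _ => h.atomSigma_le p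

theorem IsEllipticFrogProcess.measurableSet_hitEvent (h : IsEllipticFrogProcess ε P η S)
    (x z : Fin d → ℤ) : MeasurableSet (hitEvent η S x z) :=
  h.siteSigma_le x _ (measurableSet_hitEvent_siteSigma x z)

theorem IsEllipticFrogProcess.number_prob_eq (h : IsEllipticFrogProcess ε P η S)
    (x : Fin d → ℤ) (s : Set ℕ) : P.real (η x ⁻¹' s) = P.real (η 0 ⁻¹' s) := by
  rw [measureReal_def, (h.identDistrib x 0).measure_mem_eq MeasurableSet.of_discrete]
  rfl

variable [IsProbabilityMeasure P]

theorem IsEllipticFrogProcess.iIndep_siteSigma (h : IsEllipticFrogProcess ε P η S) :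
    iIndep (siteSigma η S) P :=
  iIndep_iSup_fiber h.atomSigma_le h.indep _

/-- If at least `t` frogs are present, the first `t` of them must all miss. Their trajectories are
independent of each other and of the frog number. -/
theorem IsEllipticFrogProcess.miss_prob_le (h : IsEllipticFrogProcess ε P η S) (hε : 0 < ε)
    (hε1 : ε ≤ 1) (x z : Fin d → ℤ) {n : ℕ} (hn : length (z - x) ≤ n) (t : ℕ) :
    P.real ({ω | t ≤ η x ω} ∩ (hitEvent η S x z)ᶜ)
      ≤ P.real {ω | t ≤ η x ω} * (1 - ε ^ n) ^ t := by
  classical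
  have hinj : Function.Injective fun i : ℕ =>
      (Sum.inr (x, i) : (Fin d → ℤ) ⊕ ((Fin d → ℤ) × ℕ)) := fun a b hab => by simpa using hab
  set I : Finset ((Fin d → ℤ) ⊕ ((Fin d → ℤ) × ℕ)) :=
    (Finset.range t).map ⟨_, hinj⟩ with hI
  set f : (Fin d → ℤ) ⊕ ((Fin d → ℤ) × ℕ) → Set Ω :=
    Sum.elim (fun y => {ω | t ≤ η y ω}) (fun p => {ω | ∃ j, S j p.1 p.2 ω = z}ᶜ) with hf
  have hx : Sum.inl x ∉ I := by simp [hI]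
  have hfm : ∀ p, MeasurableSet[atomSigma η S p] (f p) := by
    rintro (y | ⟨y, i⟩)
    · exact ⟨{k | t ≤ k}, MeasurableSet.of_discrete, rfl⟩
    · exact (measurableSet_path_hit_comap y z i).compl
  have hprod := h.indep.meas_biInter (S := insert (Sum.inl x) I) fun p _ => hfm p
  rw [Finset.prod_insert hx, Finset.set_biInter_insert, hI, Finset.prod_map] at hprod
  have hprod' : P.real (f (Sum.inl x) ∩ ⋂ p ∈ I, f p)
      = P.real {ω | t ≤ η x ω} * ∏ i ∈ Finset.range t, P.real (f (Sum.inr (x, i))) := by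
    rw [measureReal_def, hprod, ENNReal.toReal_mul, ENNReal.toReal_prod]
    rfl
  calc _ ≤ P.real (f (Sum.inl x) ∩ ⋂ p ∈ I, f p) := by
        refine measureReal_mono ?_
        rintro ω ⟨h1, h2⟩
        refine ⟨h1, ?_⟩
        simp only [hI, Set.mem_iInter, Finset.mem_map, Finset.mem_range, Function.Embedding.coeFn_mk]
        rintro _ ⟨i, hi, rfl⟩ h3
        exact h2 ⟨i, lt_of_lt_of_le hi h1, h3⟩
    _ = _ := hprod'
    _ ≤ _ := by
        gcongr
        calc _ ≤ ∏ i ∈ Finset.range t, (1 - ε ^ n) := by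
              refine Finset.prod_le_prod (fun _ _ => measureReal_nonneg) fun i _ => ?_
              have h1 : MeasurableSet {ω | ∃ j, S j x i ω = z} :=
                h.atomSigma_le (Sum.inr (x, i)) _ (measurableSet_path_hit_comap x z i)
              have h2 : P.real (f (Sum.inr (x, i))) = 1 - P.real {ω | ∃ j, S j x i ω = z} :=
                probReal_compl_eq_one_sub h1
              have h3 := h.path_hit_prob hε x z i
              have h4 := pow_le_pow_of_le_one hε.le hε1 hn
              linarith
          _ = _ := by simp

theorem one_sub_pow_le_half {q : ℝ} (hq0 : 0 < q) (hq1 : q ≤ 1) {t : ℕ} (ht : q⁻¹ ≤ t) :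
    (1 - q) ^ t ≤ 1 / 2 := by
  have h1 : (1 - q) ^ t ≤ Real.exp (-1) := by
    calc (1 - q) ^ t ≤ Real.exp (-q) ^ t := by
          refine pow_le_pow_left₀ (by linarith) ?_ t
          linarith [Real.add_one_le_exp (-q)]
      _ = Real.exp (-(q * t)) := by rw [← Real.exp_nat_mul]; ring_nf
      _ ≤ Real.exp (-1) := by
          gcongr
          calc (1 : ℝ) = q * q⁻¹ := (mul_inv_cancel₀ hq0.ne').symm
            _ ≤ q * t := by gcongr
  have h2 : Real.exp (-1) ≤ 1 / 2 := by
    rw [Real.exp_neg, one_div]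
    gcongr
    linarith [Real.add_one_le_exp (1 : ℝ)]
  exact h1.trans h2

theorem IsEllipticFrogProcess.half_le_hit_prob (h : IsEllipticFrogProcess ε P η S) (hε : 0 < ε)
    (hε1 : ε ≤ 1) (x z : Fin d → ℤ) {n : ℕ} (hn : length (z - x) ≤ n) :
    P.real {ω | (ε⁻¹) ^ n ≤ (η 0 ω : ℝ)} / 2 ≤ P.real (hitEvent η S x z) := by
  set t := ⌈(ε⁻¹) ^ n⌉₊ with ht
  have hset : {ω | (ε⁻¹) ^ n ≤ (η 0 ω : ℝ)} = η 0 ⁻¹' {k | t ≤ k} := by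
    ext ω; simp [ht]
  rw [hset, ← h.number_prob_eq x]
  have h1 := h.miss_prob_le hε hε1 x z hn t
  have h2 : (1 - ε ^ n) ^ t ≤ 1 / 2 := by
    refine one_sub_pow_le_half (pow_pos hε n) (pow_le_one₀ hε.le hε1) ?_
    rw [← inv_pow]
    exact Nat.le_ceil _
  have h3 := measureReal_inter_add_sdiff (μ := P) (s := {ω | t ≤ η x ω})
    (h.measurableSet_hitEvent x z)
  rw [Set.sdiff_eq] at h3
  have h4 : P.real ({ω | t ≤ η x ω} ∩ hitEvent η S x z) ≤ P.real (hitEvent η S x z) :=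
    measureReal_mono Set.inter_subset_right
  have h5 : P.real {ω | t ≤ η x ω} * (1 - ε ^ n) ^ t ≤ P.real {ω | t ≤ η x ω} * (1 / 2) := by
    gcongr
  have h6 : η x ⁻¹' {k | t ≤ k} = {ω | t ≤ η x ω} := rfl
  rw [h6]
  linarith

theorem IsEllipticFrogProcess.all_miss_prob (h : IsEllipticFrogProcess ε P η S)
    {ι : Type*} (A : Finset ι) (g : ι → Fin d → ℤ) (hg : Function.Injective g) (z : Fin d → ℤ) :
    P.real (⋂ a ∈ A, (hitEvent η S (g a) z)ᶜ) = ∏ a ∈ A, (1 - P.real (hitEvent η S (g a) z)) := by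
  rw [measureReal_def, (h.iIndep_siteSigma.precomp hg).meas_biInter fun a _ =>
    (measurableSet_hitEvent_siteSigma (g a) z).compl, ENNReal.toReal_prod]
  refine Finset.prod_congr rfl fun a _ => ?_
  exact probReal_compl_eq_one_sub (h.measurableSet_hitEvent _ _)

end Sites

/-! ### Geometry of orthants and dyadic cubes. -/

section Orthants

variable {d : ℕ}

/-- A choice of signs of the coordinates, i.e. of an orthant. -/
def IsSign (σ : Fin d → ℤ) : Prop := ∀ l, σ l = 1 ∨ σ l = -1

/-- The point with coordinates `u` in the orthant with corner `y` and signs `σ`. -/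
def shift (y σ : Fin d → ℤ) (u : Fin d → ℕ) : Fin d → ℤ := fun l => y l + σ l * u l

/-- The largest coordinate. -/
def rank (u : Fin d → ℕ) : ℕ := Finset.univ.sup u

/-- The cube `[2 ^ j, 2 ^ (j + 1)) ^ d`. -/
def block (d j : ℕ) : Finset (Fin d → ℕ) :=
  Fintype.piFinset fun _ => Finset.Ico (2 ^ j) (2 ^ (j + 1))

theorem IsSign.injective_shift {σ : Fin d → ℤ} (hσ : IsSign σ) (y : Fin d → ℤ) :
    Function.Injective (shift y σ) := by
  intro u w huw
  funext l
  have := congrFun huw l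
  simp only [shift] at this
  rcases hσ l with h | h <;> rw [h] at this <;> omega

theorem IsSign.length_shift {σ : Fin d → ℤ} (hσ : IsSign σ) (y : Fin d → ℤ) (u : Fin d → ℕ) :
    length (shift y σ u - y) = ∑ l, u l := by
  refine Finset.sum_congr rfl fun l _ => ?_
  simp only [shift, Pi.sub_apply]
  rcases hσ l with h | h <;> rw [h] <;> omega

theorem length_sub_comm (x y : Fin d → ℤ) : length (x - y) = length (y - x) := by
  refine Finset.sum_congr rfl fun l _ => ?_
  simp only [Pi.sub_apply]
  omega

theorem shift_zero (y σ : Fin d → ℤ) : shift y σ 0 = y := by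
  funext l; simp [shift]

theorem le_rank (u : Fin d → ℕ) (l : Fin d) : u l ≤ rank u :=
  Finset.le_sup (Finset.mem_univ l)

theorem exists_eq_rank (hd : 1 ≤ d) (u : Fin d → ℕ) : ∃ l, u l = rank u := by
  have : Nonempty (Fin d) := ⟨⟨0, hd⟩⟩
  obtain ⟨l, -, hl⟩ := Finset.exists_mem_eq_sup Finset.univ Finset.univ_nonempty u
  exact ⟨l, hl.symm⟩

theorem rank_lt_iff {u : Fin d → ℕ} {m : ℕ} (hm : 0 < m) : rank u < m ↔ ∀ l, u l < m := by
  rw [rank, Finset.sup_lt_iff (by simpa using hm)]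
  simp

theorem card_block (d j : ℕ) : (block d j).card = 2 ^ (j * d) := by
  rw [block, Fintype.card_piFinset]
  simp [pow_succ, mul_two, pow_mul]

theorem sum_le_of_mem_block {j : ℕ} {a : Fin d → ℕ} (ha : a ∈ block d j) :
    ∑ l, a l ≤ d * 2 ^ (j + 1) := by
  rw [block, Fintype.mem_piFinset] at ha
  calc ∑ l, a l ≤ ∑ _l : Fin d, 2 ^ (j + 1) :=
        Finset.sum_le_sum fun l _ => (Finset.mem_Ico.1 (ha l)).2.le
    _ = _ := by simp

theorem pairwiseDisjoint_block (hd : 1 ≤ d) (s : Set ℕ) : s.PairwiseDisjoint (block d) := by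
  intro i _ j _ hij
  refine Finset.disjoint_left.2 fun a hi hj => hij ?_
  rw [block, Fintype.mem_piFinset] at hi hj
  have h1 := Finset.mem_Ico.1 (hi ⟨0, hd⟩)
  have h2 := Finset.mem_Ico.1 (hj ⟨0, hd⟩)
  have h3 := (Nat.pow_lt_pow_iff_right (a := 2) (by norm_num)).1 (h1.1.trans_lt h2.2)
  have h4 := (Nat.pow_lt_pow_iff_right (a := 2) (by norm_num)).1 (h2.1.trans_lt h1.2)
  omega

/-- Every point of an orthant is a corner of cubes of points of smaller rank. -/
theorem exists_sign_forall_block (hd : 1 ≤ d) {τ : Fin d → ℤ} (hτ : IsSign τ) (y : Fin d → ℤ)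
    {u : Fin d → ℕ} {k : ℕ} (hu : 2 ^ (k + 1) ≤ rank u) :
    ∃ σ, IsSign σ ∧ ∀ j < k, ∀ a ∈ block d j, ∃ w, w ≠ 0 ∧ rank w < rank u ∧
      shift (shift y τ u) σ a = shift y τ w := by
  classical
  -- Go back towards the corner in coordinates at least half the maximum and outwards in the others.
  -- Displacements below half the maximum then stay in the orthant and lower the rank.
  set s : Fin d → ℤ := fun l => if rank u ≤ 2 * u l then -1 else 1 with hs
  refine ⟨fun l => τ l * s l, fun l => ?_, fun j hj a ha => ?_⟩
  · rcases hτ l with h | h <;> by_cases h' : rank u ≤ 2 * u l <;> simp [hs, h, h']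
  have ha' : ∀ l, 0 < a l ∧ 2 * a l < rank u := by
    intro l
    rw [block, Fintype.mem_piFinset] at ha
    have h1 := Finset.mem_Ico.1 (ha l)
    have h2 : 2 ^ (j + 1) ≤ 2 ^ k := Nat.pow_le_pow_right (by norm_num) hj
    have h3 : 0 < 2 ^ j := by positivity
    rw [pow_succ] at hu
    omega
  refine ⟨fun l => if rank u ≤ 2 * u l then u l - a l else u l + a l, ?_, ?_, ?_⟩
  · obtain ⟨l, hl⟩ := exists_eq_rank hd u
    intro h0
    have h1 := congrFun h0 l
    have h2 := ha' l
    simp only [Pi.zero_apply] at h1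
    rw [if_pos (by omega)] at h1
    omega
  · have h0 : 0 < rank u := lt_of_lt_of_le (by positivity) hu
    rw [rank_lt_iff h0]
    intro l
    have h1 := ha' l
    have h2 := le_rank u l
    split_ifs <;> omega
  · funext l
    have h1 := ha' l
    simp only [shift, hs]
    split_ifs with h
    · rw [Nat.cast_sub (by omega)]; ring
    · push_cast; ring

end Orthants

/-! ### Filling a whole orthant with positive probability. -/

section Covering

variable {d : ℕ} {Ω : Type*} {η : (Fin d → ℤ) → Ω → ℕ}
  {S : ℕ → (Fin d → ℤ) → ℕ → Ω → (Fin d → ℤ)}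

/-- Every site of the orthant of rank at least `2 ^ k` is hit from a site of smaller nonzero
rank. -/
def growEvent (η : (Fin d → ℤ) → Ω → ℕ) (S : ℕ → (Fin d → ℤ) → ℕ → Ω → (Fin d → ℤ))
    (y τ : Fin d → ℤ) (k : ℕ) : Set Ω :=
  ⋂ u ∈ {u : Fin d → ℕ | 2 ^ k ≤ rank u}, ⋃ w ∈ {w : Fin d → ℕ | w ≠ 0 ∧ rank w < rank u},
    hitEvent η S (shift y τ w) (shift y τ u)

/-- Every site of the orthant of rank less than `2 ^ k` is hit from the corner. -/
def fillEvent (η : (Fin d → ℤ) → Ω → ℕ) (S : ℕ → (Fin d → ℤ) → ℕ → Ω → (Fin d → ℤ))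
    (y τ : Fin d → ℤ) (k : ℕ) : Set Ω :=
  ⋂ u ∈ {u : Fin d → ℕ | rank u < 2 ^ k}, hitEvent η S y (shift y τ u)

theorem measurableSet_hitEvent_iSup {U : Set (Fin d → ℤ)} {x : Fin d → ℤ} (hx : x ∈ U)
    (z : Fin d → ℤ) : MeasurableSet[⨆ x ∈ U, siteSigma η S x] (hitEvent η S x z) :=
  (le_iSup₂_of_le (f := fun x (_ : x ∈ U) => siteSigma η S x) x hx le_rfl) _
    (measurableSet_hitEvent_siteSigma x z)

theorem measurableSet_growEvent {U : Set (Fin d → ℤ)} {y τ : Fin d → ℤ}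
    (hU : ∀ w, w ≠ 0 → shift y τ w ∈ U) (k : ℕ) :
    MeasurableSet[⨆ x ∈ U, siteSigma η S x] (growEvent η S y τ k) :=
  MeasurableSet.biInter (Set.to_countable _) fun _ _ => MeasurableSet.biUnion (Set.to_countable _)
    fun _ hw => measurableSet_hitEvent_iSup (hU _ hw.1) _

theorem measurableSet_fillEvent {U : Set (Fin d → ℤ)} {y : Fin d → ℤ} (hU : y ∈ U)
    (τ : Fin d → ℤ) (k : ℕ) :
    MeasurableSet[⨆ x ∈ U, siteSigma η S x] (fillEvent η S y τ k) :=
  MeasurableSet.biInter (Set.to_countable _) fun _ _ => measurableSet_hitEvent_iSup hU _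

theorem shift_mem_visited {v y τ : Fin d → ℤ} {k : ℕ} {ω : Ω} (hs : ∀ y i, S 0 y i ω = y)
    (hy : y ∈ visited (fun x => η x ω) (fun j x i => S j x i ω) v)
    (hf : ω ∈ fillEvent η S y τ k) (hg : ω ∈ growEvent η S y τ k) (u : Fin d → ℕ) :
    shift y τ u ∈ visited (fun x => η x ω) (fun j x i => S j x i ω) v := by
  induction hr : rank u using Nat.strong_induction_on generalizing u with
  | _ r ih =>
    subst hr
    by_cases hu : rank u < 2 ^ k
    · obtain ⟨i, hi, j, hj⟩ := Set.mem_iInter₂.1 hf u hu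
      rw [← hj]
      exact mem_visited_of_step hs hy hi j
    · obtain ⟨w, hw, i, hi, j, hj⟩ := Set.mem_iUnion₂.1 (Set.mem_iInter₂.1 hg u (not_lt.1 hu))
      rw [← hj]
      exact mem_visited_of_step hs (ih _ hw.2 w rfl) hi j

variable {ε : ℝ} [MeasurableSpace Ω] {P : Measure Ω} [IsProbabilityMeasure P]

/-- The lower bound for hitting probabilities on which the covering estimates rest. -/
def HitBound (η : (Fin d → ℤ) → Ω → ℕ) (S : ℕ → (Fin d → ℤ) → ℕ → Ω → (Fin d → ℤ))
    (P : Measure Ω) (j₀ : ℕ) : Prop :=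
  ∀ j ≥ j₀, ∀ x z : Fin d → ℤ, length (z - x) ≤ d * 2 ^ (j + 1) →
    (d + 1) * Real.log 2 / 2 ^ (j * d) ≤ P.real (hitEvent η S x z)

theorem IsEllipticFrogProcess.exists_hitBound (h : IsEllipticFrogProcess ε P η S) (hd : 1 ≤ d)
    (hε : 0 < ε) (hε1 : ε < 1)
    (htail : ∀ᶠ t : ℝ in atTop, 2 * ((d + 1) * Real.log 2) * (2 * d * Real.log ε⁻¹) ^ d /
      (Real.log t) ^ d ≤ P.real {ω | t ≤ (η 0 ω : ℝ)}) :
    ∃ j₀, HitBound η S P j₀ := by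
  have hL : 0 < Real.log ε⁻¹ := Real.log_pos ((one_lt_inv₀ hε).2 hε1)
  have hlim : Tendsto (fun j : ℕ => (ε⁻¹) ^ (d * 2 ^ (j + 1))) atTop atTop := by
    refine (tendsto_pow_atTop_atTop_of_one_lt ((one_lt_inv₀ hε).2 hε1)).comp ?_
    refine tendsto_atTop_mono (fun j => ?_) tendsto_id
    have : j < 2 ^ (j + 1) := (Nat.lt_succ_self j).trans (Nat.lt_two_pow_self)
    exact this.le.trans (Nat.le_mul_of_pos_left _ hd)
  obtain ⟨j₀, hj₀⟩ := eventually_atTop.1 (hlim.eventually htail)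
  refine ⟨j₀, fun j hj x z hxz => ?_⟩
  refine le_trans ?_ (h.half_le_hit_prob hε hε1.le x z hxz)
  have h1 := hj₀ j hj
  rw [Real.log_pow] at h1
  -- At `t = ε⁻¹ ^ (d * 2 ^ (j + 1))` one has `log t = 2 ^ j * (2 * d * log ε⁻¹)`. The leading
  -- factor 2 pays for the 1/2 in `half_le_hit_prob`.
  have h2 : 2 * ((d + 1) * Real.log 2) * (2 * d * Real.log ε⁻¹) ^ d /
      (((d * 2 ^ (j + 1) : ℕ) : ℝ) * Real.log ε⁻¹) ^ d
      = 2 * ((d + 1) * Real.log 2 / 2 ^ (j * d)) := by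
    have hd' : (0 : ℝ) < d := by exact_mod_cast hd
    have h3 : ((d * 2 ^ (j + 1) : ℕ) : ℝ) * Real.log ε⁻¹ = 2 ^ j * (2 * d * Real.log ε⁻¹) := by
      push_cast; ring
    rw [h3, mul_pow (2 ^ j : ℝ), ← pow_mul]
    have h4 : (2 * d * Real.log ε⁻¹) ^ d ≠ 0 := by positivity
    generalize (2 * d * Real.log ε⁻¹) ^ d = A at h4
    field_simp
  rw [h2] at h1
  linarith

theorem IsEllipticFrogProcess.miss_blocks_prob_le (h : IsEllipticFrogProcess ε P η S) (hd : 1 ≤ d)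
    {j₀ : ℕ} (hB : HitBound η S P j₀) {σ : Fin d → ℤ} (hσ : IsSign σ) (z : Fin d → ℤ) (r : ℕ) :
    P.real (⋂ a ∈ (Finset.Ico j₀ (j₀ + r)).biUnion (block d), (hitEvent η S (shift z σ a) z)ᶜ)
      ≤ (1 / 2) ^ ((d + 1) * r) := by
  rw [h.all_miss_prob _ _ (hσ.injective_shift z), Finset.prod_biUnion (pairwiseDisjoint_block hd _)]
  have hnonneg : ∀ a, 0 ≤ 1 - P.real (hitEvent η S (shift z σ a) z) :=
    fun a => sub_nonneg.2 measureReal_le_one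
  have hblock : ∀ j ∈ Finset.Ico j₀ (j₀ + r),
      ∏ a ∈ block d j, (1 - P.real (hitEvent η S (shift z σ a) z)) ≤ (1 / 2 : ℝ) ^ (d + 1) := by
    intro j hj
    set q : ℝ := (d + 1) * Real.log 2 / 2 ^ (j * d) with hq
    calc _ ≤ ∏ a ∈ block d j, Real.exp (-q) := by
          refine Finset.prod_le_prod (fun a _ => hnonneg a) fun a ha => ?_
          have h1 := hB j (Finset.mem_Ico.1 hj).1 (shift z σ a) z (by
            rw [length_sub_comm, hσ.length_shift]
            exact sum_le_of_mem_block ha)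
          linarith [Real.add_one_le_exp (-q)]
      _ = Real.exp (-q) ^ (2 ^ (j * d)) := by rw [Finset.prod_const, card_block]
      _ = Real.exp (-(((d + 1 : ℕ) : ℝ) * Real.log 2)) := by
          rw [← Real.exp_nat_mul, hq]
          congr 1
          push_cast
          field_simp
      _ = _ := by
          rw [Real.exp_neg, Real.exp_nat_mul, Real.exp_log (by norm_num)]
          simp
  calc _ ≤ ∏ j ∈ Finset.Ico j₀ (j₀ + r), (1 / 2 : ℝ) ^ (d + 1) := by
        exact Finset.prod_le_prod (fun j _ => Finset.prod_nonneg fun a _ => hnonneg a) hblock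
    _ = _ := by simp [← pow_mul]

/-- Each site of the annulus is the corner of `r` usable cubes, so it is missed with probability at
most `2 ^ (-(d + 1) r)`. The exponent `d + 1` beats the `2 ^ (d r)` growth of the annulus. -/
theorem IsEllipticFrogProcess.miss_annulus_prob_le (h : IsEllipticFrogProcess ε P η S)
    (hd : 1 ≤ d)
    {j₀ : ℕ} (hB : HitBound η S P j₀) {τ : Fin d → ℤ} (hτ : IsSign τ) (y : Fin d → ℤ) (r : ℕ) :
    P.real (⋃ u ∈ (Fintype.piFinset fun _ : Fin d => Finset.range (2 ^ (j₀ + r + 2))).filter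
        fun u => 2 ^ (j₀ + r + 1) ≤ rank u,
      ⋂ w ∈ {w : Fin d → ℕ | w ≠ 0 ∧ rank w < rank u},
        (hitEvent η S (shift y τ w) (shift y τ u))ᶜ) ≤ 2 ^ ((j₀ + 2) * d) * (1 / 2) ^ r := by
  have hu : ∀ u ∈ (Fintype.piFinset fun _ : Fin d => Finset.range (2 ^ (j₀ + r + 2))).filter
        fun u => 2 ^ (j₀ + r + 1) ≤ rank u,
      P.real (⋂ w ∈ {w : Fin d → ℕ | w ≠ 0 ∧ rank w < rank u},
        (hitEvent η S (shift y τ w) (shift y τ u))ᶜ) ≤ (1 / 2) ^ ((d + 1) * r) := by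
    intro u hu
    obtain ⟨σ, hσ, hblock⟩ := exists_sign_forall_block hd hτ y (Finset.mem_filter.1 hu).2
    refine le_trans (measureReal_mono ?_) (h.miss_blocks_prob_le hd hB hσ (shift y τ u) r)
    intro ω hω
    refine Set.mem_iInter₂.2 fun a ha => ?_
    obtain ⟨j, hj, ha⟩ := Finset.mem_biUnion.1 ha
    obtain ⟨w, hw0, hw, heq⟩ := hblock j (Finset.mem_Ico.1 hj).2 a ha
    rw [heq]
    exact Set.mem_iInter₂.1 hω w ⟨hw0, hw⟩
  calc _ ≤ _ := measureReal_biUnion_finset_le _ _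
    _ ≤ _ := Finset.sum_le_card_nsmul _ _ _ hu
    _ ≤ ((2 ^ (j₀ + r + 2)) ^ d : ℕ) • ((1 / 2 : ℝ) ^ ((d + 1) * r)) := by
        refine nsmul_le_nsmul_left (by positivity) ?_
        refine (Finset.card_filter_le _ _).trans ?_
        rw [Fintype.card_piFinset]
        simp
    _ = _ := by
        rw [nsmul_eq_mul]
        push_cast
        have : (2 : ℝ) ^ ((j₀ + r + 2) * d) = 2 ^ ((j₀ + 2) * d) * 2 ^ (d * r) := by
          rw [← pow_add]; ring_nf
        have h2 : (2 : ℝ) ^ (d * r) * (1 / 2) ^ (d * r) = 1 := by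
          rw [← mul_pow]; norm_num
        have h3 : (1 / 2 : ℝ) ^ ((d + 1) * r) = (1 / 2) ^ (d * r) * (1 / 2) ^ r := by
          rw [← pow_add]; ring_nf
        rw [← pow_mul, this, h3, mul_assoc, ← mul_assoc (2 ^ (d * r)), h2, one_mul]

theorem IsEllipticFrogProcess.exists_half_le_growEvent_prob (h : IsEllipticFrogProcess ε P η S)
    (hd : 1 ≤ d) {j₀ : ℕ} (hB : HitBound η S P j₀) :
    ∃ k, ∀ y τ : Fin d → ℤ, IsSign τ → 1 / 2 ≤ P.real (growEvent η S y τ k) := by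
  -- Chosen so that the geometric series of annulus bounds from `r₀` on sums to exactly 1/2.
  obtain ⟨r₀, hr₀⟩ : ∃ r₀, r₀ = (j₀ + 2) * d + 2 := ⟨_, rfl⟩
  refine ⟨j₀ + r₀ + 1, fun y τ hτ => ?_⟩
  set B : ℕ → Set Ω := fun r =>
    ⋃ u ∈ (Fintype.piFinset fun _ : Fin d => Finset.range (2 ^ (j₀ + r + 2))).filter
        fun u => 2 ^ (j₀ + r + 1) ≤ rank u,
      ⋂ w ∈ {w : Fin d → ℕ | w ≠ 0 ∧ rank w < rank u},
        (hitEvent η S (shift y τ w) (shift y τ u))ᶜ with hBdef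
  have hsub : (growEvent η S y τ (j₀ + r₀ + 1))ᶜ ⊆ ⋃ i, B (r₀ + i) := by
    intro ω hω
    simp only [growEvent, Set.mem_compl_iff, Set.mem_iInter, not_forall] at hω
    obtain ⟨u, hu, hω⟩ := hω
    have hu : 2 ^ (j₀ + r₀ + 1) ≤ rank u := hu
    have hpos : rank u ≠ 0 := by
      have : 0 < 2 ^ (j₀ + r₀ + 1) := by positivity
      omega
    have h1 := Nat.pow_log_le_self 2 hpos
    have h2 := Nat.lt_pow_succ_log_self (b := 2) (by norm_num) (rank u)
    have h3 : j₀ + r₀ + 1 ≤ Nat.log 2 (rank u) :=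
      Nat.le_log_of_pow_le (by norm_num) hu
    obtain ⟨i, hi⟩ := Nat.exists_eq_add_of_le h3
    have hi1 : Nat.log 2 (rank u) = j₀ + (r₀ + i) + 1 := by omega
    rw [hi1] at h1 h2
    refine Set.mem_iUnion.2 ⟨i, Set.mem_iUnion₂.2 ⟨u, ?_, ?_⟩⟩
    · rw [Finset.mem_filter, Fintype.mem_piFinset]
      exact ⟨fun l => Finset.mem_range.2 ((le_rank u l).trans_lt h2), h1⟩
    · simpa [Set.mem_iUnion] using hω
  have hsum : HasSum (fun i : ℕ => (2 : ℝ) ^ ((j₀ + 2) * d) * (1 / 2) ^ (r₀ + i))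
      (1 / 2) := by
    have := (hasSum_geometric_two).mul_left ((2 : ℝ) ^ ((j₀ + 2) * d) * (1 / 2) ^ r₀)
    have h2 : (2 : ℝ) ^ ((j₀ + 2) * d) * (1 / 2) ^ r₀ * 2 = 1 / 2 := by
      rw [hr₀, pow_add, ← mul_assoc, ← mul_pow]; norm_num
    rw [h2] at this
    simpa only [pow_add, mul_assoc] using this
  have hc : P.real (growEvent η S y τ (j₀ + r₀ + 1))ᶜ ≤ 1 / 2 := by
    refine ENNReal.toReal_le_of_le_ofReal (by norm_num) ?_
    calc _ ≤ _ := measure_mono hsub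
      _ ≤ _ := measure_iUnion_le _
      _ ≤ ∑' i, ENNReal.ofReal ((2 : ℝ) ^ ((j₀ + 2) * d) * (1 / 2) ^ (r₀ + i)) := by
          refine ENNReal.tsum_le_tsum fun i => ?_
          rw [← ofReal_measureReal (measure_ne_top P _)]
          exact ENNReal.ofReal_le_ofReal (h.miss_annulus_prob_le hd hB hτ y (r₀ + i))
      _ = _ := by
          rw [← ENNReal.ofReal_tsum_of_nonneg (fun i => by positivity) hsum.summable, hsum.tsum_eq]
  have hm : MeasurableSet (growEvent η S y τ (j₀ + r₀ + 1)) :=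
    (iSup₂_le fun x _ => h.siteSigma_le x) _
      (measurableSet_growEvent (U := Set.univ) (fun _ _ => trivial) _)
  rw [probReal_compl_eq_one_sub hm] at hc
  linarith

/-- Only finitely many sites are to be hit, so enough frogs at the corner hit all of them with
conditional probability at least 1/2. -/
theorem IsEllipticFrogProcess.exists_le_fillEvent_prob (h : IsEllipticFrogProcess ε P η S)
    (hε : 0 < ε) (hε1 : ε < 1) (hpos : ∀ t : ℕ, 0 < P.real {ω | t ≤ η 0 ω}) (k : ℕ) :
    ∃ p > 0, ∀ y τ : Fin d → ℤ, IsSign τ → p ≤ P.real (fillEvent η S y τ k) := by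
  set T : Finset (Fin d → ℕ) := Fintype.piFinset fun _ => Finset.range (2 ^ k) with hT
  set n := d * 2 ^ k with hn
  obtain ⟨t, ht⟩ : ∃ t : ℕ, T.card * (1 - ε ^ n) ^ t ≤ 1 / 2 := by
    have h1 : Tendsto (fun t : ℕ => T.card * (1 - ε ^ n) ^ t) atTop (nhds (T.card * 0)) :=
      (tendsto_pow_atTop_nhds_zero_of_lt_one
        (by linarith [pow_le_one₀ (n := n) hε.le hε1.le])
        (by linarith [pow_pos hε n])).const_mul _
    rw [mul_zero] at h1
    exact (h1.eventually_le_const (by norm_num : (0 : ℝ) < 1 / 2)).exists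
  refine ⟨P.real {ω | t ≤ η 0 ω} / 2, half_pos (hpos t), fun y τ hτ => ?_⟩
  have heq : P.real {ω | t ≤ η 0 ω} = P.real {ω | t ≤ η y ω} :=
    (h.number_prob_eq y {m | t ≤ m}).symm
  rw [heq]
  have hsub : {ω | t ≤ η y ω} ⊆ fillEvent η S y τ k ∪
      ⋃ u ∈ T, ({ω | t ≤ η y ω} ∩ (hitEvent η S y (shift y τ u))ᶜ) := by
    intro ω hω
    by_cases hf : ω ∈ fillEvent η S y τ k
    · exact Or.inl hf
    · right
      simp only [fillEvent, Set.mem_iInter, not_forall] at hf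
      obtain ⟨u, hu, hf⟩ := hf
      refine Set.mem_iUnion₂.2 ⟨u, ?_, hω, hf⟩
      rw [hT, Fintype.mem_piFinset]
      exact fun l => Finset.mem_range.2 ((rank_lt_iff (by positivity)).1 hu l)
  have h1 := (measureReal_mono (μ := P) hsub).trans (measureReal_union_le _ _)
  have h2 : P.real (⋃ u ∈ T, ({ω | t ≤ η y ω} ∩ (hitEvent η S y (shift y τ u))ᶜ))
      ≤ T.card • (P.real {ω | t ≤ η y ω} * (1 - ε ^ n) ^ t) := by
    refine (measureReal_biUnion_finset_le _ _).trans (Finset.sum_le_card_nsmul _ _ _ fun u hu => ?_)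
    refine h.miss_prob_le hε hε1.le y _ ?_ t
    rw [hτ.length_shift]
    rw [hT, Fintype.mem_piFinset] at hu
    calc ∑ l, u l ≤ ∑ _l : Fin d, 2 ^ k :=
          Finset.sum_le_sum fun l _ => (Finset.mem_range.1 (hu l)).le
      _ = _ := by simp [hn]
  have h3 : T.card • (P.real {ω | t ≤ η y ω} * (1 - ε ^ n) ^ t)
      ≤ P.real {ω | t ≤ η y ω} * (1 / 2) := by
    rw [nsmul_eq_mul, mul_left_comm]
    gcongr
  linarith

/-- Excluding `w = 0` in `growEvent` makes it independent of the corner's frogs, which alone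
determine `fillEvent`. -/
theorem IsEllipticFrogProcess.exists_le_fill_inter_grow_prob (h : IsEllipticFrogProcess ε P η S)
    (hd : 1 ≤ d) (hε : 0 < ε) (hε1 : ε < 1) (hpos : ∀ t : ℕ, 0 < P.real {ω | t ≤ η 0 ω})
    {j₀ : ℕ} (hB : HitBound η S P j₀) :
    ∃ k, ∃ p > 0, ∀ y τ : Fin d → ℤ, IsSign τ →
      p ≤ P.real (fillEvent η S y τ k ∩ growEvent η S y τ k) := by
  obtain ⟨k, hgrow⟩ := h.exists_half_le_growEvent_prob hd hB
  obtain ⟨p, hp, hfill⟩ := h.exists_le_fillEvent_prob hε hε1 hpos k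
  refine ⟨k, p * (1 / 2), by positivity, fun y τ hτ => ?_⟩
  have hind := indep_iSup_of_disjoint h.siteSigma_le h.iIndep_siteSigma
    (disjoint_compl_right (a := ({y} : Set (Fin d → ℤ))))
  have hw : ∀ w, w ≠ 0 → shift y τ w ∈ ({y} : Set (Fin d → ℤ))ᶜ := by
    intro w hw hmem
    refine hw (hτ.injective_shift y ?_)
    rw [shift_zero]
    exact hmem
  have heq : P.real (fillEvent η S y τ k ∩ growEvent η S y τ k)
      = P.real (fillEvent η S y τ k) * P.real (growEvent η S y τ k) := by
    have hf := measurableSet_fillEvent (η := η) (S := S) (Set.mem_singleton y) τ k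
    have hg := measurableSet_growEvent (η := η) (S := S) hw k
    rw [measureReal_def, (Indep_iff _ _ P).1 hind _ _ hf hg, ENNReal.toReal_mul]
    rfl
  rw [heq]
  exact mul_le_mul (hfill y τ hτ) (hgrow y τ hτ) (by norm_num) measureReal_nonneg

end Covering

/-- If the events `A y` have probabilities bounded below and `A y` only depends on the coordinates
at least as far out as `y`, then almost surely one of the events of an infinite family occurs. -/
theorem ae_exists_mem_of_indep {ι Ω : Type*} [Countable ι] {m0 : MeasurableSpace Ω}
    {P : Measure Ω} [IsProbabilityMeasure P] {m : ι → MeasurableSpace Ω} (hle : ∀ i, m i ≤ m0)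
    (hm : iIndep m P) (ρ : ι → ℕ) (hρ : ∀ n, {x | ρ x ≤ n}.Finite) {A : ι → Set Ω}
    (hA : ∀ y, MeasurableSet[⨆ x ∈ {x | ρ y ≤ ρ x}, m x] (A y)) {p : ℝ} (hp : 0 < p)
    (hpA : ∀ y, p ≤ P.real (A y)) {Y : Set ι} (hY : Y.Infinite) :
    ∀ᵐ ω ∂P, ∃ y ∈ Y, ω ∈ A y := by
  set U : ℕ → Set Ω := fun n => ⋃ y ∈ {y | y ∈ Y ∧ n ≤ ρ y}, A y with hU
  have hUanti : Antitone U := by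
    intro a b hab ω hω
    obtain ⟨y, hy, hyω⟩ := Set.mem_iUnion₂.1 hω
    exact Set.mem_iUnion₂.2 ⟨y, ⟨hy.1, hab.trans hy.2⟩, hyω⟩
  have hUmeas : ∀ n, MeasurableSet[⨆ x ∈ {x | n ≤ ρ x}, m x] (U n) := by
    intro n
    refine MeasurableSet.biUnion (Set.to_countable _) fun y hy => ?_
    refine (iSup₂_le fun x hx => ?_ :
      (⨆ x ∈ {x | ρ y ≤ ρ x}, m x) ≤ ⨆ x ∈ {x | n ≤ ρ x}, m x) _ (hA y)
    exact le_iSup₂_of_le (f := fun x (_ : x ∈ {x | n ≤ ρ x}) => m x) x (hy.2.trans hx) le_rfl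
  have hUm0 : ∀ n, MeasurableSet (U n) := fun n => (iSup₂_le fun x _ => hle x) _ (hUmeas n)
  -- The decreasing unions have a tail event as intersection, of probability at least `p > 0`, hence
  -- 1.
  have htail : MeasurableSet[limsup m cofinite] (⋂ n, U n) := by
    rw [limsup_eq_iInf_iSup, MeasurableSpace.measurableSet_iInf]
    intro s
    rw [MeasurableSpace.measurableSet_iInf]
    intro hs
    obtain ⟨N, hN⟩ := ((mem_cofinite.1 hs).image ρ).bddAbove
    have heq : ⋂ n, U n = ⋂ n, U (N + 1 + n) := by
      refine subset_antisymm (fun ω hω => ?_) (fun ω hω => ?_)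
      · exact Set.mem_iInter.2 fun n => Set.mem_iInter.1 hω _
      · exact Set.mem_iInter.2 fun n => hUanti (Nat.le_add_left n (N + 1)) (Set.mem_iInter.1 hω n)
    rw [heq]
    refine MeasurableSet.iInter fun n => ?_
    refine (iSup₂_le fun x hx => ?_ :
      (⨆ x ∈ {x | N + 1 + n ≤ ρ x}, m x) ≤ ⨆ x ∈ s, m x) _ (hUmeas _)
    have hxs : x ∈ s := by
      by_contra hxs
      have h1 := hN ⟨x, hxs, rfl⟩
      have h2 : N + 1 + n ≤ ρ x := hx
      omega
    exact le_iSup₂_of_le (f := fun x (_ : x ∈ s) => m x) x hxs le_rfl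
  have h01 : P (⋂ n, U n) = 0 ∨ P (⋂ n, U n) = 1 := by
    refine measure_zero_or_one_of_measurableSet_limsup (p := Set.Finite)
      (ns := fun n : ℕ => {x | ρ x ≤ n}) hle hm (fun t ht => ht.compl_mem_cofinite) ?_ hρ
      (fun x => ⟨ρ x, le_refl (ρ x)⟩) htail
    exact Monotone.directed_le fun a b hab x hx => le_trans hx hab
  have hlow : ∀ n, ENNReal.ofReal p ≤ P (U n) := by
    intro n
    obtain ⟨y, hy, hyn⟩ := hY.exists_notMem_finite (hρ n)
    have hyn' : n ≤ ρ y := (not_le.1 hyn).le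
    rw [← ofReal_measureReal (measure_ne_top P _)]
    refine ENNReal.ofReal_le_ofReal ((hpA y).trans (measureReal_mono ?_ (measure_ne_top P _)))
    exact fun ω hω => Set.mem_iUnion₂.2 ⟨y, ⟨hy, hyn'⟩, hω⟩
  have hlim := tendsto_measure_iInter_atTop (μ := P) (fun n => (hUm0 n).nullMeasurableSet) hUanti
    ⟨0, measure_ne_top P _⟩
  have hge := ge_of_tendsto' hlim hlow
  have hone : P (⋂ n, U n) = 1 := by
    refine h01.resolve_left fun h0 => ?_
    rw [h0, nonpos_iff_eq_zero, ENNReal.ofReal_eq_zero] at hge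
    linarith
  have hae := (prob_compl_eq_zero_iff (MeasurableSet.iInter hUm0)).2 hone
  filter_upwards [compl_mem_ae_iff.2 hae] with ω hω
  rw [compl_compl] at hω
  obtain ⟨y, hy, hyω⟩ := Set.mem_iUnion₂.1 (Set.mem_iInter.1 hω 0)
  exact ⟨y, hy.1, hyω⟩

theorem measurable_of_measurableSet_apply {ι Ω : Type*} {m : MeasurableSpace Ω}
    {f : Ω → ι → Prop} (hf : ∀ y, MeasurableSet {ω | f ω y}) : Measurable f :=
  measurable_pi_iff.2 fun y => measurableSet_setOfPred.1 (hf y)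

/-! ### Recurrence under the tail condition. -/

section Recurrence

variable {d : ℕ}

theorem finite_length_le (v : Fin d → ℤ) (n : ℕ) : {x | length (x - v) ≤ n}.Finite := by
  refine (Set.finite_Icc (fun l => v l - n) (fun l => v l + n)).subset fun x hx => ?_
  have h : ∀ l, (x l - v l).natAbs ≤ n := fun l =>
    (Finset.single_le_sum (f := fun l => ((x - v) l).natAbs) (fun _ _ => Nat.zero_le _)
      (Finset.mem_univ l)).trans hx
  refine ⟨fun l => ?_, fun l => ?_⟩
  · have := h l; simp only; omega
  · have := h l; simp only; omega

theorem length_sub_pos {x v : Fin d → ℤ} (h : x ≠ v) : 0 < length (x - v) := by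
  by_contra h0
  refine h (funext fun l => ?_)
  have h1 : length (x - v) = 0 := by omega
  have h2 := Finset.sum_eq_zero_iff.1 h1 l (Finset.mem_univ l)
  simp only [Pi.sub_apply] at h2
  omega

/-- The signs of the orthant of `y` as seen from `v`. -/
def signAt (v y : Fin d → ℤ) : Fin d → ℤ := fun l => if v l ≤ y l then 1 else -1

theorem isSign_signAt (v y : Fin d → ℤ) : IsSign (signAt v y) := by
  intro l
  unfold signAt
  split_ifs <;> simp

theorem length_le_length_shift (v y : Fin d → ℤ) (w : Fin d → ℕ) :
    length (y - v) ≤ length (shift y (signAt v y) w - v) := by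
  refine Finset.sum_le_sum fun l _ => ?_
  simp only [Pi.sub_apply, shift, signAt]
  split_ifs <;> omega

theorem exists_shift_eq_shift (v y : Fin d → ℤ) {a : Fin d → ℕ}
    (ha : ∀ l, length (y - v) ≤ a l) :
    ∃ u, shift v (signAt v y) a = shift y (signAt v y) u := by
  refine ⟨fun l => a l - (y l - v l).natAbs, funext fun l => ?_⟩
  have h : (y l - v l).natAbs ≤ a l :=
    (Finset.single_le_sum (f := fun l => ((y - v) l).natAbs) (fun _ _ => Nat.zero_le _)
      (Finset.mem_univ l)).trans (ha l)
  simp only [shift, signAt]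
  split_ifs <;> omega

variable {Ω : Type*} {η : (Fin d → ℤ) → Ω → ℕ} {S : ℕ → (Fin d → ℤ) → ℕ → Ω → (Fin d → ℤ)}
  {ε : ℝ} [MeasurableSpace Ω] {P : Measure Ω} [IsProbabilityMeasure P]

/-- A trajectory with infinite range meets one of a family of likely events which depend on the
other sites further out. -/
theorem IsEllipticFrogProcess.ae_exists_path_mem (h : IsEllipticFrogProcess ε P η S)
    (v : Fin d → ℤ) (i : ℕ) {A : (Fin d → ℤ) → Set Ω}
    (hA : ∀ y, MeasurableSet[⨆ x ∈ {x | length (y - v) ≤ length (x - v)}, siteSigma η S x] (A y))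
    {p : ℝ} (hp : 0 < p) (hpA : ∀ y, p ≤ P.real (A y))
    (hinf : ∀ᵐ ω ∂P, (Set.range fun j => S j v i ω).Infinite) :
    ∀ᵐ ω ∂P, ∃ j, ω ∈ A (S j v i ω) := by
  set X : Ω → ℕ → Fin d → ℤ := fun ω j => S j v i ω with hX
  -- Dropping `y = v` leaves events that ignore the frogs of `v`, so `I` is independent of the
  -- trajectory. Fubini then allows the trajectory to be frozen.
  set I : Ω → (Fin d → ℤ) → Prop := fun ω y => y ≠ v ∧ ω ∈ A y with hI
  have hXm : Measurable X := measurable_pi_lambda _ fun j => h.measurable_position j v i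
  have hIm' : Measurable[⨆ x ∈ ({v} : Set (Fin d → ℤ))ᶜ, siteSigma η S x] I := by
    refine measurable_of_measurableSet_apply fun y => ?_
    by_cases hy : y = v
    · simp only [hI, hy, ne_eq, not_true_eq_false, false_and]
      exact @MeasurableSet.empty _ (_)
    · simp only [hI, ne_eq, hy, not_false_eq_true, true_and]
      refine (iSup₂_le fun x hx => ?_ :
        (⨆ x ∈ {x | length (y - v) ≤ length (x - v)}, siteSigma η S x) ≤
          ⨆ x ∈ ({v} : Set (Fin d → ℤ))ᶜ, siteSigma η S x) _ (hA y)
      have hxv : x ∈ ({v} : Set (Fin d → ℤ))ᶜ := by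
        rintro rfl
        have h1 := length_sub_pos hy
        have h2 : length (y - x) ≤ length (x - x) := hx
        have h3 : length (x - x) = 0 := by simp [length]
        omega
      exact le_iSup₂_of_le (f := fun x (_ : x ∈ ({v} : Set (Fin d → ℤ))ᶜ) => siteSigma η S x)
        x hxv le_rfl
  have hIm : Measurable I := hIm'.mono (iSup₂_le fun x _ => h.siteSigma_le x) le_rfl
  have hindep : IndepFun X I P := by
    have hind := indep_iSup_of_disjoint h.siteSigma_le h.iIndep_siteSigma
      (disjoint_compl_right (a := ({v} : Set (Fin d → ℤ))))
    refine indep_of_indep_of_le_left (indep_of_indep_of_le_right hind hIm'.comap_le) ?_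
    exact le_iSup₂_of_le (f := fun x (_ : x ∈ ({v} : Set (Fin d → ℤ))) => siteSigma η S x)
      v rfl (measurable_path_siteSigma v i).comap_le
  set B : Set ((ℕ → Fin d → ℤ) × ((Fin d → ℤ) → Prop)) :=
    {q | (∀ F : Finset (Fin d → ℤ), ∃ j, q.1 j ∉ F) ∧ ∀ j, ¬ q.2 (q.1 j)} with hB
  have hBm : MeasurableSet B := by
    have hB' : B = (⋂ F : Finset (Fin d → ℤ), ⋃ j, (fun q => q.1 j) ⁻¹' (F : Set (Fin d → ℤ))ᶜ) ∩
        ⋂ j, ⋃ y, ((fun q => q.1 j) ⁻¹' {y} ∩ {q | q.2 y}ᶜ) := by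
      ext q
      simp [hB]
    rw [hB']
    refine (MeasurableSet.iInter fun F => MeasurableSet.iUnion fun j => ?_).inter
      (MeasurableSet.iInter fun j => MeasurableSet.iUnion fun y => MeasurableSet.inter ?_ ?_)
    · exact ((measurable_pi_apply j).comp measurable_fst) MeasurableSet.of_discrete
    · exact ((measurable_pi_apply j).comp measurable_fst) MeasurableSet.of_discrete
    · exact (measurableSet_setOfPred.2 ((measurable_pi_apply y).comp measurable_snd)).compl
  have hnull : P ((fun ω => (X ω, I ω)) ⁻¹' B) = 0 := by
    rw [← Measure.map_apply (hXm.prodMk hIm) hBm,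
      (indepFun_iff_map_prod_eq_prod_map_map hXm.aemeasurable hIm.aemeasurable).1 hindep]
    have : IsProbabilityMeasure (P.map I) := Measure.isProbabilityMeasure_map hIm.aemeasurable
    rw [Measure.measure_prod_null hBm]
    refine Eventually.of_forall fun q => ?_
    change P.map I (Prod.mk q ⁻¹' B) = 0
    rw [Measure.map_apply hIm (measurable_prodMk_left hBm)]
    by_cases hq : ∀ F : Finset (Fin d → ℤ), ∃ j, q j ∉ F
    · have hY : (Set.range q \ {v}).Infinite := by
        refine Set.Infinite.sdiff (fun hfin => ?_) (Set.finite_singleton v)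
        obtain ⟨j, hj⟩ := hq hfin.toFinset
        exact hj (hfin.mem_toFinset.2 ⟨j, rfl⟩)
      have hae := ae_exists_mem_of_indep h.siteSigma_le h.iIndep_siteSigma
        (fun x => length (x - v)) (finite_length_le v) hA hp hpA hY
      refine measure_mono_null ?_ (ae_iff.1 hae)
      rintro ω ⟨-, hω⟩ ⟨y, ⟨⟨j, rfl⟩, hj⟩, hy⟩
      exact hω j ⟨hj, hy⟩
    · have : I ⁻¹' (Prod.mk q ⁻¹' B) = ∅ := by
        ext ω
        simp only [hB, Set.mem_preimage, Set.mem_ofPred_eq, Set.mem_empty_iff_false, iff_false]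
        exact fun hω => hq hω.1
      rw [this]
      simp
  filter_upwards [hinf, compl_mem_ae_iff.2 hnull] with ω hω1 hω2
  by_contra! hcon
  refine hω2 ⟨fun F => ?_, fun j hj => hcon j hj.2⟩
  obtain ⟨_, ⟨j, rfl⟩, hj⟩ := hω1.exists_notMem_finset F
  exact ⟨j, hj⟩

theorem IsEllipticFrogProcess.ae_hits_from_orthant (h : IsEllipticFrogProcess ε P η S)
    (hd : 1 ≤ d) {j₀ : ℕ} (hB : HitBound η S P j₀) {σ : Fin d → ℤ} (hσ : IsSign σ)
    (v : Fin d → ℤ) :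
    ∀ᵐ ω ∂P, ∀ M : ℕ, ∃ a : Fin d → ℕ, (∀ l, M ≤ a l) ∧ ω ∈ hitEvent η S (shift v σ a) v := by
  rw [ae_all_iff]
  intro M
  have hB' : HitBound η S P (max j₀ M) := fun j hj => hB j ((le_max_left _ _).trans hj)
  rw [ae_iff, ← measureReal_eq_zero_iff]
  refine le_antisymm (ge_of_tendsto' (f := fun r : ℕ => ((1 / 2 : ℝ) ^ (d + 1)) ^ r)
    (tendsto_pow_atTop_nhds_zero_of_lt_one (by positivity)
      (pow_lt_one₀ (by norm_num) (by norm_num) (by omega))) fun r => ?_) measureReal_nonneg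
  rw [← pow_mul]
  refine le_trans (measureReal_mono ?_) (h.miss_blocks_prob_le hd hB' hσ v r)
  intro ω hω
  refine Set.mem_iInter₂.2 fun a ha hmem => hω ⟨a, fun l => ?_, hmem⟩
  obtain ⟨j, hj, ha⟩ := Finset.mem_biUnion.1 ha
  rw [block, Fintype.mem_piFinset] at ha
  calc M ≤ max j₀ M := le_max_right _ _
    _ ≤ j := (Finset.mem_Ico.1 hj).1
    _ ≤ 2 ^ j := Nat.lt_two_pow_self.le
    _ ≤ a l := (Finset.mem_Ico.1 (ha l)).1

theorem IsEllipticFrogProcess.ae_isRecurrent (h : IsEllipticFrogProcess ε P η S)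
    (hd : 1 ≤ d) (hε : 0 < ε) (hε1 : ε < 1) (hpos : ∀ t : ℕ, 0 < P.real {ω | t ≤ η 0 ω})
    {j₀ : ℕ} (hB : HitBound η S P j₀) :
    ∀ᵐ ω ∂P, ∀ v, 1 ≤ η v ω → IsRecurrent (fun y => η y ω) (fun j y i => S j y i ω) v := by
  rw [ae_all_iff]
  intro v
  obtain ⟨k, p, hp, hpA⟩ := h.exists_le_fill_inter_grow_prob hd hε hε1 hpos hB
  have hmeet := h.ae_exists_path_mem v 0
    (A := fun y => fillEvent η S y (signAt v y) k ∩ growEvent η S y (signAt v y) k)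
    (fun y => (measurableSet_fillEvent (Set.mem_ofPred_eq ▸ le_rfl) _ _).inter
      (measurableSet_growEvent (fun w _ => length_le_length_shift v y w) _))
    hp (fun y => hpA y _ (isSign_signAt v y)) (h.ae_infinite_range hε hε1.le hd v 0)
  have hhit : ∀ᵐ ω ∂P, ∀ σ : Fin d → ℤ, IsSign σ → ∀ M : ℕ, ∃ a : Fin d → ℕ,
      (∀ l, M ≤ a l) ∧ ω ∈ hitEvent η S (shift v σ a) v :=
    ae_all_iff.2 fun σ => ae_all_iff.2 fun hσ => h.ae_hits_from_orthant hd hB hσ v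
  filter_upwards [hmeet, hhit] with ω ⟨j, hfill, hgrow⟩ hhit hv hfin
  have hs : ∀ y i, S 0 y i ω = y := fun y i => h.start y i ω
  set y := S j v 0 ω with hy
  have hyv : y ∈ visited (fun x => η x ω) (fun j x i => S j x i ω) v :=
    mem_visited_of_step (n := fun x => η x ω) (s := fun j x i => S j x i ω) hs
      self_mem_visited hv j
  obtain ⟨N, hN⟩ := (hfin.image fun x => length (x - v)).bddAbove
  -- The term `length (y - v)` places the point in the filled orthant of `y`; `N + 1` places it
  -- beyond the supposedly finite set.
  obtain ⟨a, ha, hav⟩ := hhit _ (isSign_signAt v y) (N + 1 + length (y - v))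
  obtain ⟨u, hu⟩ := exists_shift_eq_shift v y (a := a) fun l => le_trans (by omega) (ha l)
  have hvis : shift v (signAt v y) a ∈ visited (fun x => η x ω) (fun j x i => S j x i ω) v := by
    rw [hu]
    exact shift_mem_visited hs hyv hfill hgrow u
  have h1 := hN ⟨_, ⟨hvis, hav⟩, rfl⟩
  simp only [(isSign_signAt v y).length_shift] at h1
  have h2 := Finset.single_le_sum (f := a) (fun _ _ => Nat.zero_le _)
    (Finset.mem_univ (⟨0, hd⟩ : Fin d))
  have h3 := ha ⟨0, hd⟩
  omega

end Recurrence

theorem exists_eq_of_unbounded {p : ℕ → ℤ} (hstep : ∀ j, |p (j + 1) - p j| ≤ 1)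
    (hub : ∀ N : ℕ, ∃ j, (N : ℤ) < p j) {b : ℤ} (hb : p 0 ≤ b) : ∃ j, p j = b := by
  classical
  have hex : ∃ j, b ≤ p j := by
    obtain ⟨j, hj⟩ := hub b.toNat
    exact ⟨j, by omega⟩
  refine ⟨Nat.find hex, ?_⟩
  have h1 := Nat.find_spec hex
  rcases hj : Nat.find hex with _ | j
  · rw [hj] at h1
    omega
  · have h2 := Nat.find_min hex (m := j) (by omega)
    have h3 := hstep j
    rw [hj] at h1
    rw [abs_le] at h3
    omega

/-! ### Dimension one under the logarithmic moment condition. -/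

section OneDimensional

variable {Ω : Type*} {η : (Fin 1 → ℤ) → Ω → ℕ} {S : ℕ → (Fin 1 → ℤ) → ℕ → Ω → (Fin 1 → ℤ)}
  {ε : ℝ} [MeasurableSpace Ω] {P : Measure Ω}

/-- Up to the factor `log ε⁻¹`, the positive logarithm is at most the number of `n` with `ε⁻¹ ^ n ≤
η 0`; integrate this count. -/
theorem tsum_number_prob_eq_top (hη : Measurable (η 0)) (hε : 0 < ε) (hε1 : ε < 1)
    (hmom : ∫⁻ ω, ENNReal.ofReal (Real.posLog (η 0 ω : ℝ)) ∂P = ⊤) :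
    ∑' n : ℕ, P {ω | (ε⁻¹) ^ n ≤ (η 0 ω : ℝ)} = ⊤ := by
  have hL : 0 < Real.log ε⁻¹ := Real.log_pos ((one_lt_inv₀ hε).2 hε1)
  have hm : ∀ n : ℕ, MeasurableSet {ω | (ε⁻¹) ^ n ≤ (η 0 ω : ℝ)} := fun n =>
    hη (MeasurableSet.of_discrete (s := {k : ℕ | (ε⁻¹) ^ n ≤ (k : ℝ)}))
  have hpt : ∀ ω, ENNReal.ofReal (Real.posLog (η 0 ω : ℝ)) ≤ ENNReal.ofReal (Real.log ε⁻¹) *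
      ∑' n : ℕ, {ω | (ε⁻¹) ^ n ≤ (η 0 ω : ℝ)}.indicator 1 ω := by
    intro ω
    rcases Nat.eq_zero_or_pos (η 0 ω) with h0 | h0
    · simp [h0]
    have hη1 : (1 : ℝ) ≤ (η 0 ω : ℝ) := by exact_mod_cast h0
    have hlog : 0 ≤ Real.log (η 0 ω : ℝ) := Real.log_nonneg hη1
    set N := ⌊Real.log (η 0 ω : ℝ) / Real.log ε⁻¹⌋₊ with hN
    have hsum : ((N + 1 : ℕ) : ENNReal) ≤
        ∑' n : ℕ, {ω | (ε⁻¹) ^ n ≤ (η 0 ω : ℝ)}.indicator (1 : Ω → ENNReal) ω := by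
      refine le_trans (le_of_eq ?_) (ENNReal.sum_le_tsum (Finset.range (N + 1)))
      rw [Finset.sum_congr rfl (g := fun _ => 1)]
      · simp
      intro n hn
      refine Set.indicator_of_mem ?_ _
      have h1 : (n : ℝ) ≤ Real.log (η 0 ω : ℝ) / Real.log ε⁻¹ := by
        refine le_trans ?_ (Nat.floor_le (div_nonneg hlog hL.le))
        exact_mod_cast Nat.lt_succ_iff.1 (Finset.mem_range.1 hn)
      rw [le_div_iff₀ hL, ← Real.log_pow] at h1
      exact (Real.log_le_log_iff (by positivity) (by linarith)).1 h1
    calc _ ≤ ENNReal.ofReal (Real.log ε⁻¹ * ((N + 1 : ℕ) : ℝ)) := by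
          refine ENNReal.ofReal_le_ofReal ?_
          rw [show Real.posLog (η 0 ω : ℝ) = Real.log (η 0 ω : ℝ) from max_eq_right hlog, mul_comm, ← div_le_iff₀ hL]
          push_cast
          exact (Nat.lt_floor_add_one _).le
      _ = ENNReal.ofReal (Real.log ε⁻¹) * ((N + 1 : ℕ) : ENNReal) := by
          rw [ENNReal.ofReal_mul hL.le, ENNReal.ofReal_natCast]
      _ ≤ _ := by gcongr
  by_contra hne
  have h1 := lintegral_mono (μ := P) hpt
  rw [hmom, lintegral_const_mul' _ _ ENNReal.ofReal_ne_top,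
    lintegral_tsum fun n => (measurable_one.indicator (hm n)).aemeasurable] at h1
  simp only [lintegral_indicator_one (hm _)] at h1
  exact ENNReal.mul_ne_top ENNReal.ofReal_ne_top hne (top_le_iff.1 h1)

variable [IsProbabilityMeasure P]

theorem IsEllipticFrogProcess.ae_infinite_hits_of_posLog (h : IsEllipticFrogProcess ε P η S)
    (hε : 0 < ε) (hε1 : ε < 1) (hmom : ∫⁻ ω, ENNReal.ofReal (Real.posLog (η 0 ω : ℝ)) ∂P = ⊤)
    {σ : Fin 1 → ℤ} (hσ : IsSign σ) (v : Fin 1 → ℤ) :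
    ∀ᵐ ω ∂P, {n : ℕ | ω ∈ hitEvent η S (shift v σ fun _ => n) v}.Infinite := by
  set s : ℕ → Set Ω := fun n => hitEvent η S (shift v σ fun _ => n) v with hs
  have hinj : Function.Injective fun n : ℕ => shift v σ fun _ => n := fun a b hab =>
    congrFun (hσ.injective_shift v hab) 0
  have hm : ∀ n, MeasurableSet (s n) := fun n => h.measurableSet_hitEvent _ _
  have hind : iIndepSet s P := by
    rw [iIndepSet_iff_meas_biInter hm]
    intro T
    exact (h.iIndep_siteSigma.precomp hinj).meas_biInter fun n _ =>
      measurableSet_hitEvent_siteSigma _ _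
  have hsum : ∑' n, P (s n) = ⊤ := by
    have hle : ∀ n : ℕ, P {ω | (ε⁻¹) ^ n ≤ (η 0 ω : ℝ)} * 2⁻¹ ≤ P (s n) := by
      intro n
      have h1 := h.half_le_hit_prob hε hε1.le (shift v σ fun _ => n) v (n := n) (by
        rw [length_sub_comm, hσ.length_shift]; simp)
      rw [← ofReal_measureReal (measure_ne_top P (s n)),
        ← ofReal_measureReal (measure_ne_top P {ω | (ε⁻¹) ^ n ≤ (η 0 ω : ℝ)})]
      have h2 : (2⁻¹ : ENNReal) = ENNReal.ofReal 2⁻¹ := by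
        rw [ENNReal.ofReal_inv_of_pos (by norm_num)]; simp
      rw [h2, ← ENNReal.ofReal_mul measureReal_nonneg]
      exact ENNReal.ofReal_le_ofReal h1
    refine top_le_iff.1 (le_trans (le_of_eq ?_) (ENNReal.tsum_le_tsum hle))
    rw [ENNReal.tsum_mul_right, tsum_number_prob_eq_top (h.measurable_number 0) hε hε1 hmom]
    simp
  have hone := measure_limsup_eq_one hm hind hsum
  have hnull := (prob_compl_eq_zero_iff (MeasurableSet.measurableSet_limsup hm)).2 hone
  filter_upwards [compl_mem_ae_iff.2 hnull] with ω hω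
  rw [compl_compl, mem_limsup_iff_frequently_mem] at hω
  exact Nat.frequently_atTop_iff_infinite.1 hω

theorem IsEllipticFrogProcess.ae_isRecurrent_of_posLog (h : IsEllipticFrogProcess ε P η S)
    (hε : 0 < ε) (hε1 : ε < 1)
    (hjump : ∀ x i j, ∀ᵐ ω ∂P, ∑ k, |S (j + 1) x i ω k - S j x i ω k| ≤ 1)
    (hmom : ∫⁻ ω, ENNReal.ofReal (Real.posLog (η 0 ω : ℝ)) ∂P = ⊤) :
    ∀ᵐ ω ∂P, ∀ v, 1 ≤ η v ω → IsRecurrent (fun y => η y ω) (fun j y i => S j y i ω) v := by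
  rw [ae_all_iff]
  intro v
  have hhit : ∀ᵐ ω ∂P, ∀ σ : Fin 1 → ℤ, IsSign σ →
      {n : ℕ | ω ∈ hitEvent η S (shift v σ fun _ => n) v}.Infinite :=
    ae_all_iff.2 fun σ => ae_all_iff.2 fun hσ => h.ae_infinite_hits_of_posLog hε hε1 hmom hσ v
  filter_upwards [h.ae_unbounded hε hε1.le v 0 0, ae_all_iff.2 (hjump v 0), hhit]
    with ω hunb hstep hhit hv
  have hs : ∀ y i, S 0 y i ω = y := fun y i => h.start y i ω
  -- The side `τ` is random, which is why the returns were secured for both signs simultaneously.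
  obtain ⟨τ, hτ, hτunb⟩ : ∃ τ : ℤ, (τ = 1 ∨ τ = -1) ∧ ∀ N : ℕ, ∃ j, (N : ℤ) < τ * S j v 0 ω 0 := by
    by_contra! hcon
    obtain ⟨N₁, h1⟩ := hcon 1 (Or.inl rfl)
    obtain ⟨N₂, h2⟩ := hcon (-1) (Or.inr rfl)
    obtain ⟨j, hj⟩ := hunb (max N₁ N₂)
    have h3 := h1 j
    have h4 := h2 j
    rw [lt_abs] at hj
    push_cast at hj
    omega
  have hvisit : ∀ n : ℕ, ∃ j, S j v 0 ω = shift v (fun _ => τ) fun _ => n := by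
    intro n
    obtain ⟨j, hj⟩ := exists_eq_of_unbounded (p := fun j => τ * S j v 0 ω 0) (b := τ * v 0 + n)
      (fun j => by
        have h1 := hstep j
        simp only [Fin.sum_univ_one] at h1
        rw [abs_le] at h1 ⊢
        rcases hτ with rfl | rfl <;> omega) hτunb (by simp only [hs]; omega)
    refine ⟨j, funext fun l => ?_⟩
    rw [Subsingleton.elim l 0]
    simp only [shift] at hj ⊢
    rcases hτ with rfl | rfl <;> omega
  have hinj : Function.Injective fun n : ℕ => shift v (fun _ => τ) fun _ => n := fun a b hab =>
    congrFun (IsSign.injective_shift (fun _ => hτ) v hab) 0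
  refine ((hhit (fun _ => τ) fun _ => hτ).image hinj.injOn).mono ?_
  rintro _ ⟨n, hn, rfl⟩
  refine ⟨?_, hn⟩
  obtain ⟨j, hj⟩ := hvisit n
  simp only
  rw [← hj]
  exact mem_visited_of_step (n := fun y => η y ω) (s := fun j y i => S j y i ω) hs
    self_mem_visited hv j

end OneDimensional

end FrogModel

theorem theorem3 (d : ℕ) (hd : 1 ≤ d) (ε : ℝ) (hε : 0 < ε) (hεd : ε ≤ 1 / (2 * (d : ℝ))) :
    (∃ c : ℝ, 0 < c ∧
      ∀ (Ω : Type*) [MeasurableSpace Ω] (P : Measure Ω) [IsProbabilityMeasure P]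
        (η : (Fin d → ℤ) → Ω → ℕ) (S : ℕ → (Fin d → ℤ) → ℕ → Ω → (Fin d → ℤ)),
        FrogModel.IsEllipticFrogProcess ε P η S →
        (∀ᶠ t : ℝ in atTop, c / (Real.log t) ^ d ≤ P.real {ω | t ≤ (η 0 ω : ℝ)}) →
        ∀ᵐ ω ∂P, ∀ x, 1 ≤ η x ω →
          FrogModel.IsRecurrent (fun y => η y ω) (fun j y i => S j y i ω) x) ∧
    (d = 1 →
      ∀ (Ω : Type*) [MeasurableSpace Ω] (P : Measure Ω) [IsProbabilityMeasure P]
        (η : (Fin d → ℤ) → Ω → ℕ) (S : ℕ → (Fin d → ℤ) → ℕ → Ω → (Fin d → ℤ)),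
        FrogModel.IsEllipticFrogProcess ε P η S →
        (∀ x i j, ∀ᵐ ω ∂P, ∑ k, |S (j + 1) x i ω k - S j x i ω k| ≤ 1) →
        ∫⁻ ω, ENNReal.ofReal (Real.posLog (η 0 ω : ℝ)) ∂P = ⊤ →
        ∀ᵐ ω ∂P, ∀ x, 1 ≤ η x ω →
          FrogModel.IsRecurrent (fun y => η y ω) (fun j y i => S j y i ω) x) := by
  have hd' : (1 : ℝ) ≤ d := by exact_mod_cast hd
  have hε1 : ε < 1 := by
    refine hεd.trans_lt ?_
    rw [div_lt_one (by positivity)]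
    linarith
  have hL : 0 < Real.log ε⁻¹ := Real.log_pos ((one_lt_inv₀ hε).2 hε1)
  refine ⟨⟨2 * ((d + 1) * Real.log 2) * (2 * d * Real.log ε⁻¹) ^ d, by positivity, ?_⟩, ?_⟩
  · intro Ω _ P _ η S h htail
    obtain ⟨j₀, hB⟩ := h.exists_hitBound hd hε hε1 htail
    -- The tail bound at one large `t'` above `t` already shows that `η 0` is unbounded.
    refine h.ae_isRecurrent hd hε hε1 (fun t => ?_) hB
    obtain ⟨t', ht', htt, ht1⟩ :=
      (htail.and ((eventually_ge_atTop (t : ℝ)).and (eventually_gt_atTop 1))).exists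
    have hlog := Real.log_pos ht1
    refine lt_of_lt_of_le (by positivity) (ht'.trans (measureReal_mono fun ω hω => ?_))
    have : (t : ℝ) ≤ (η 0 ω : ℝ) := htt.trans hω
    exact_mod_cast this
  · rintro rfl Ω _ P _ η S h hjump hmom
    exact h.ae_isRecurrent_of_posLog hε hε1 hjump hmom
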